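/- Fix an integer $k\ge 1$. For $n\ge 2$, build a random directed graph on $V=\{v_1,\dots,v_n\}$ (the \emph{$k$-approximate line}) as follows. Start with no edges. For $j=1,\dots,n$ in turn, the node $v_j$ draws $k$ candidates $u_1,\dots,u_k$ independently and uniformly, with replacement, from $V\setminus\{v_j\}$ (independently of the past), chooses a candidate $u$ of least current in-degree, and the edge $v_j\to u$ is added. Ties may be broken by any rule, possibly randomized, that uses only the graph built so far, the node $v_j$ and its candidates. The degree of a node is its in-degree plus its out-degree, and $d_{\max}$ denotes the largest degree of a node in the final graph, i.e. the largest point of the support of the empirical degree distribution. Then, with probability $1-o(1)$ as $n\to\infty$, \[ d_{\max}=\begin{cases}\dfrac{\log n}{\log\log n}\,(1+o(1))+\Theta(1) & \text{if } k=1,\\[2ex] \dfrac{\log\log n}{\log k}\,(1+o(1))+\Theta(1) & \text{if } k>1.\end{cases} \] Precisely: writing $a_n$ for $\log n/\log\log n$ if $k=1$ and for $\log\log n/\log k$ if $k>1$, there are real sequences $\varepsilon_n\to0$ and $\eta_n\to 0$ and constants $0<c\le C$, depending only on $k$, such that for every $n\ge2$ and every tie-breaking rule, with probability at least $1-\eta_n$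 one has $d_{\max}=a_n(1+\delta)+\theta$ for some (random) reals $\delta,\theta$ with $|\delta|\le\varepsilon_n$ and $c\le\theta\le C$. -/

import Mathlib

open Filter Topology

namespace ApproxLine

section Digraphs

variable {V : Type*} [DecidableEq V]

/-- In-degree of `u` in the directed graph with edge set `E`
(the pair `(v, u)` is the edge from `v` to `u`). -/
def inDeg (E : Finset (V × V)) (u : V) : ℕ := (E.filter fun e => e.2 = u).card

/-- Out-degree of `u` in the directed graph with edge set `E`. -/
def outDeg (E : Finset (V × V)) (u : V) : ℕ := (E.filter fun e => e.1 = u).card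

/-- Degree of `u`: the number of directed edges that leave or enter `u`. -/
def deg (E : Finset (V × V)) (u : V) : ℕ := outDeg E u + inDeg E u

/-- The largest degree of a node, that is, the largest point in the support of the empirical
degree distribution. -/
def maxDeg [Fintype V] (E : Finset (V × V)) : ℕ := Finset.univ.sup (deg E)

/-- The set of nodes of least current in-degree among the candidates `u 0, …, u (k - 1)`. -/
def argminInDeg {k : ℕ} (E : Finset (V × V)) (u : Fin k → V) : Set V :=
  {w | w ∈ Set.range u ∧ ∀ i, inDeg E w ≤ inDeg E (u i)}

/-- A (possibly randomized) way to break ties in the choice of a candidate of least in-degree.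
It may use the graph built so far, the connecting node and its candidates. -/
structure TieRule (V : Type*) [DecidableEq V] (k : ℕ) where
  /-- law of the node selected, given the graph so far, the connecting node, the candidates -/
  pick : Finset (V × V) → V → (Fin k → V) → PMF V
  /-- the node selected always has least in-degree among the candidates -/
  support_subset : ∀ E v u, (pick E v u).support ⊆ argminInDeg E u

end Digraphs

section Algorithm

variable {V : Type*}

instance nonempty_ne [Nontrivial V] (v : V) : Nonempty {w : V // w ≠ v} :=
  let ⟨w, hw⟩ := exists_ne v
  ⟨⟨w, hw⟩⟩

variable [Fintype V] [DecidableEq V] [Nontrivial V]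

/-- `k` independent uniform samples, with replacement, from the nodes other than `v`. -/
noncomputable def candidates (k : ℕ) (v : V) : PMF (Fin k → V) :=
  (PMF.uniformOfFintype (Fin k → {w : V // w ≠ v})).map fun u i => (u i : V)

/-- One round: `v` draws its candidates, selects one of least current in-degree, and the edge
from `v` to it is added to the graph. -/
noncomputable def step {k : ℕ} (τ : TieRule V k) (v : V) (E : Finset (V × V)) :
    PMF (Finset (V × V)) :=
  (candidates k v).bind fun u => (τ.pick E v u).map fun w => insert (v, w) E

/-- Law of the random edge set of the `k`-approximate line on the nodes `0, …, n - 1`: starting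
from the empty graph, the nodes connect one after the other. -/
noncomputable def kApproxLine {n k : ℕ} [Nontrivial (Fin n)] (τ : TieRule (Fin n) k) :
    PMF (Finset (Fin n × Fin n)) :=
  (List.finRange n).foldl (fun law v => law.bind (step τ v)) (PMF.pure ∅)

end Algorithm

/-- Probability of the event `S` under the discrete law `p`. -/
noncomputable def prob {α : Type*} (p : PMF α) (S : Set α) : ℝ := (p.toOuterMeasure S).toReal

/-- The leading term: `log n / log log n` for `k = 1` and `log log n / log k` for `k > 1`. -/
noncomputable def leadingTerm (k n : ℕ) : ℝ :=
  if k = 1 then Real.log n / Real.log (Real.log n) else Real.log (Real.log n) / Real.log k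

end ApproxLine

/-! Each node sends out at most one edge, so the maximal degree is the maximal in-degree up to an
additive 1. Since the leading term `a` tends to infinity, it suffices that the maximal in-degree is
`a (1 + o(1))` in probability, uniformly in the tie rule; bounded errors are absorbed by the `o(1)`.

Let `heavy E i` be the nodes of in-degree at least `i`. A node enters level `i + 1` only if all `k`
candidates lie in level `i`, so the density of level `i + 1` is governed by the `k`-th power of the
density of level `i`.

Upper bound, `k ≥ 2`: layered induction. Level `s` has density at most about `1/s` by counting
edges, and the densities then fall like `2 ^ (-k ^ j)`, so nothing is left after about `log log n /
log k` levels (`mul_prob_card_heavy_succ_le`, `prob_heavy_nonempty_le`). Upper bound, `k = 1`: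
in-degrees have Poisson-like tails, seen through the exponential moment `∑ x ^ inDeg`
(`rpow_mul_prob_exists_inDeg_le`).

Lower bound, all `k`: the nodes are cut into `m` phases. If level `i` is populated when a phase
starts, enough nodes reach level `i + 1` during that phase (`prob_card_heavy_succ_lt_le`). The
densities obey `x (i + 1) = x i ^ k / D` and survive `m` phases while `D ^ (1 + k + ⋯ + k ^ (m -
1))` is small against `n` (`prob_heavy_eq_empty_le`); `eventually_mul_log_le` gives this for `m ≤ (1
- ε) a`. -/

namespace ApproxLine

/-! ### Expectations and probabilities under finite discrete laws. -/

section Expectation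

lemma prob_nonneg {α : Type*} (p : PMF α) (S : Set α) : 0 ≤ prob p S := ENNReal.toReal_nonneg

variable {α β : Type*} [Fintype α] [Fintype β]

/-- Expectation of a real function under a law on a finite type. -/
noncomputable def expect (p : PMF α) (f : α → ℝ) : ℝ := ∑ a, (p a).toReal * f a

lemma expect_pure (a : α) (f : α → ℝ) : expect (PMF.pure a) f = f a := by
  classical
  simp only [expect, PMF.pure_apply]
  rw [Finset.sum_eq_single a] <;> simp +contextual

lemma expect_bind (p : PMF α) (g : α → PMF β) (f : β → ℝ) :
    expect (p.bind g) f = expect p fun a => expect (g a) f := by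
  have h : ∀ b, ((p.bind g) b).toReal = ∑ a, (p a).toReal * (g a b).toReal := fun b => by
    rw [PMF.bind_apply, tsum_fintype, ENNReal.toReal_sum]
    · simp
    · exact fun a _ => ENNReal.mul_ne_top (p.apply_ne_top a) ((g a).apply_ne_top b)
  simp only [expect, h, Finset.sum_mul, Finset.mul_sum, mul_assoc]
  exact Finset.sum_comm

lemma expect_map (p : PMF α) (g : α → β) (f : β → ℝ) :
    expect (p.map g) f = expect p fun a => f (g a) := by
  rw [← PMF.bind_pure_comp, expect_bind]
  simp [expect_pure]

lemma expect_mono {p : PMF α} {f g : α → ℝ} (h : ∀ a ∈ p.support, f a ≤ g a) :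
    expect p f ≤ expect p g := by
  refine Finset.sum_le_sum fun a _ => ?_
  by_cases ha : a ∈ p.support
  · exact mul_le_mul_of_nonneg_left (h a ha) ENNReal.toReal_nonneg
  · rw [PMF.mem_support_iff, not_not] at ha
    simp [ha]

lemma expect_const (p : PMF α) (c : ℝ) : expect p (fun _ => c) = c := by
  have h : ∑ a, (p a).toReal = 1 := by
    rw [← ENNReal.toReal_sum fun a _ => p.apply_ne_top a, ← tsum_fintype (L := .unconditional α),
      p.tsum_coe, ENNReal.toReal_one]
  simp [expect, ← Finset.sum_mul, h]

lemma expect_add (p : PMF α) (f g : α → ℝ) :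
    expect p (fun a => f a + g a) = expect p f + expect p g := by
  simp [expect, mul_add, Finset.sum_add_distrib]

lemma expect_const_mul (p : PMF α) (c : ℝ) (f : α → ℝ) :
    expect p (fun a => c * f a) = c * expect p f := by
  simp only [expect, Finset.mul_sum]
  exact Finset.sum_congr rfl fun a _ => by ring

lemma expect_sum {ι : Type*} (s : Finset ι) (p : PMF α) (f : ι → α → ℝ) :
    expect p (fun a => ∑ i ∈ s, f i a) = ∑ i ∈ s, expect p (f i) := by
  simp only [expect, Finset.mul_sum]
  exact Finset.sum_comm

open Classical in
lemma prob_eq_expect (p : PMF α) (S : Set α) :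
    prob p S = expect p fun a => if a ∈ S then 1 else 0 := by
  rw [prob, PMF.toOuterMeasure_apply_fintype, ENNReal.toReal_sum]
  · refine Finset.sum_congr rfl fun a _ => ?_
    by_cases h : a ∈ S <;> simp [h]
  · intro a _
    by_cases h : a ∈ S <;> simp [h, p.apply_ne_top]

lemma prob_mono {p : PMF α} {S T : Set α} (h : ∀ a ∈ p.support, a ∈ S → a ∈ T) :
    prob p S ≤ prob p T := by
  classical
  rw [prob_eq_expect, prob_eq_expect]
  refine expect_mono fun a ha => ?_
  have := h a ha
  split_ifs <;> simp_all

lemma prob_union_le (p : PMF α) (S T : Set α) : prob p (S ∪ T) ≤ prob p S + prob p T := by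
  classical
  simp only [prob_eq_expect, ← expect_add]
  refine expect_mono fun a _ => ?_
  by_cases h1 : a ∈ S <;> by_cases h2 : a ∈ T <;> simp [h1, h2]

lemma prob_compl (p : PMF α) (S : Set α) : prob p Sᶜ = 1 - prob p S := by
  classical
  rw [eq_sub_iff_add_eq, prob_eq_expect, prob_eq_expect, ← expect_add]
  rw [← expect_const p 1]
  congr 1
  funext a
  by_cases h : a ∈ S <;> simp [h, expect_const]

/-- Markov's inequality. -/
lemma mul_prob_le_expect {p : PMF α} {S : Set α} {f : α → ℝ} {c : ℝ}
    (h0 : ∀ a ∈ p.support, 0 ≤ f a) (h : ∀ a ∈ p.support, a ∈ S → c ≤ f a) :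
    c * prob p S ≤ expect p f := by
  classical
  rw [prob_eq_expect, ← expect_const_mul]
  refine expect_mono fun a ha => ?_
  by_cases haS : a ∈ S
  · simpa [haS] using h a ha haS
  · simpa [haS] using h0 a ha

lemma prob_bind (p : PMF α) (g : α → PMF β) (S : Set β) :
    prob (p.bind g) S = expect p fun a => prob (g a) S := by
  classical
  simp only [prob_eq_expect, expect_bind]

/-- If `g a` charges `S` at most `r` off a bad set of values of `a`, so does the mixture up to the
probability of the bad set. -/
lemma prob_bind_le {p : PMF α} {g : α → PMF β} {S : Set β} {T : Set α} {r : ℝ} (hr : 0 ≤ r)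
    (h : ∀ a ∈ p.support, a ∉ T → prob (g a) S ≤ r) :
    prob (p.bind g) S ≤ prob p T + r := by
  classical
  rw [prob_bind, prob_eq_expect p T, ← expect_const p r, ← expect_add]
  refine expect_mono fun a ha => ?_
  by_cases haT : a ∈ T
  · have : prob (g a) S ≤ 1 := by
      have := prob_nonneg (g a) Sᶜ
      rw [prob_compl] at this
      linarith
    simp only [haT, if_true]
    linarith [expect_const p r]
  · simpa [haT, expect_const] using h a ha haT

end Expectation

/-! ### How in-degrees and levels change when an edge is added. -/

section Graph

variable {V : Type*} [DecidableEq V]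

lemma inDeg_insert_of_ne (E : Finset (V × V)) (v : V) {w u : V} (h : w ≠ u) :
    inDeg (insert (v, w) E) u = inDeg E u := by
  simp [inDeg, Finset.filter_insert, h]

lemma inDeg_insert_le (E : Finset (V × V)) (v w u : V) :
    inDeg (insert (v, w) E) u ≤ inDeg E u + if w = u then 1 else 0 := by
  by_cases h : w = u
  · simp only [inDeg, Finset.filter_insert, h, if_true]
    exact Finset.card_insert_le _ _
  · simp [inDeg_insert_of_ne E v h, h]

/-- Edges form a `Finset`, so only a new edge raises the in-degree; this is why lower bounds have to
track `Fresh`. -/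
lemma inDeg_insert_self {E : Finset (V × V)} {v w : V} (h : (v, w) ∉ E) :
    inDeg (insert (v, w) E) w = inDeg E w + 1 := by
  simp [inDeg, Finset.filter_insert, h]

lemma inDeg_mono {E F : Finset (V × V)} (h : E ⊆ F) (u : V) : inDeg E u ≤ inDeg F u :=
  Finset.card_le_card (Finset.filter_subset_filter _ h)

/-- No edge of `E` leaves a node of `l`. -/
def Fresh (l : List V) (E : Finset (V × V)) : Prop := ∀ v ∈ l, ∀ w, (v, w) ∉ E

lemma Fresh.insert {l : List V} {v : V} {E : Finset (V × V)} (h : Fresh (v :: l) E)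
    (hv : v ∉ l) (w : V) : Fresh l (insert (v, w) E) := by
  intro a ha b hab
  rcases Finset.mem_insert.1 hab with hab | hab
  · simp only [Prod.mk.injEq] at hab
    exact hv (hab.1 ▸ ha)
  · exact h a (List.mem_cons_of_mem _ ha) b hab

variable [Fintype V]

/-- The nodes of in-degree at least `i`. -/
def heavy (E : Finset (V × V)) (i : ℕ) : Finset V := Finset.univ.filter fun u => i ≤ inDeg E u

@[simp] lemma mem_heavy {E : Finset (V × V)} {i : ℕ} {u : V} : u ∈ heavy E i ↔ i ≤ inDeg E u := by
  simp [heavy]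

lemma heavy_mono {E F : Finset (V × V)} (h : E ⊆ F) (i : ℕ) : heavy E i ⊆ heavy F i := by
  intro u
  simp only [mem_heavy]
  exact fun hu => hu.trans (inDeg_mono h u)

lemma heavy_anti (E : Finset (V × V)) {i j : ℕ} (h : i ≤ j) : heavy E j ⊆ heavy E i := by
  intro u
  simp only [mem_heavy]
  exact h.trans

lemma card_heavy_insert_le (E : Finset (V × V)) (v w : V) (i : ℕ) :
    (heavy (insert (v, w) E) (i + 1)).card ≤
      (heavy E (i + 1)).card + if i ≤ inDeg E w then 1 else 0 := by
  have key : ∀ u ∈ heavy (insert (v, w) E) (i + 1), u ∉ heavy E (i + 1) →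
      u = w ∧ i ≤ inDeg E w := by
    intro u hu hu'
    simp only [mem_heavy] at hu hu'
    have := inDeg_insert_le E v w u
    by_cases h : w = u
    · subst h
      simp at this
      exact ⟨rfl, by omega⟩
    · simp [h] at this
      omega
  split_ifs with hi
  · refine (Finset.card_le_card (t := insert w (heavy E (i + 1))) fun u hu => ?_).trans
      (Finset.card_insert_le _ _)
    by_cases hu' : u ∈ heavy E (i + 1)
    · exact Finset.mem_insert_of_mem hu'
    · simp [(key u hu hu').1]
  · refine Finset.card_le_card fun u hu => ?_
    by_contra hu'
    exact hi (key u hu hu').2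

lemma card_heavy_insert_of_inDeg_eq {E : Finset (V × V)} {v w : V} {i : ℕ} (h : (v, w) ∉ E)
    (hw : inDeg E w = i) :
    (heavy E (i + 1)).card + 1 ≤ (heavy (insert (v, w) E) (i + 1)).card := by
  rw [← Finset.card_insert_of_notMem (a := w) (s := heavy E (i + 1)) (by simp [hw])]
  refine Finset.card_le_card fun u hu => ?_
  rcases Finset.mem_insert.1 hu with rfl | hu
  · simp [inDeg_insert_self h, hw]
  · exact heavy_mono (Finset.subset_insert _ _) _ hu

/-- In-degrees sum to the number of edges. This deterministic bound starts the layered induction. -/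
lemma card_heavy_mul_le (E : Finset (V × V)) (i : ℕ) : (heavy E i).card * i ≤ E.card := by
  have h : ∑ u, inDeg E u = E.card :=
    (Finset.card_eq_sum_card_fiberwise (f := fun e : V × V => e.2) (s := E) (t := Finset.univ)
      fun _ _ => Finset.mem_coe.2 (Finset.mem_univ _)).symm
  rw [← h, ← smul_eq_mul]
  refine (Finset.card_nsmul_le_sum _ _ _ fun u hu => mem_heavy.1 hu).trans ?_
  exact Finset.sum_le_sum_of_subset (Finset.subset_univ _)

end Graph

/-! ### The process as a Markov chain, and drift estimates along it. -/

section Evolution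

variable {V : Type*} [Fintype V] [DecidableEq V] [Nontrivial V] {k : ℕ}

/-- The process started from a given graph, for a given list of connecting nodes. -/
noncomputable def run (τ : TieRule V k) : List V → Finset (V × V) → PMF (Finset (V × V))
  | [], E => PMF.pure E
  | v :: l, E => (step τ v E).bind (run τ l)

lemma foldl_bind_step (τ : TieRule V k) (l : List V) (p : PMF (Finset (V × V))) :
    l.foldl (fun law v => law.bind (step τ v)) p = p.bind (run τ l) := by
  induction l generalizing p with
  | nil => exact (PMF.bind_pure p).symm
  | cons v l ih => rw [List.foldl_cons, ih, PMF.bind_bind]; rfl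

lemma kApproxLine_eq_run {n : ℕ} [Nontrivial (Fin n)] (τ : TieRule (Fin n) k) :
    kApproxLine τ = run τ (List.finRange n) ∅ := by
  rw [kApproxLine, foldl_bind_step, PMF.pure_bind]

lemma run_append (τ : TieRule V k) (l₁ l₂ : List V) (E : Finset (V × V)) :
    run τ (l₁ ++ l₂) E = (run τ l₁ E).bind (run τ l₂) := by
  induction l₁ generalizing E with
  | nil => exact (PMF.pure_bind _ _).symm
  | cons v l ih =>
    simp only [List.cons_append, run, PMF.bind_bind]
    congr 1
    funext F
    exact ih F

lemma exists_of_mem_support_step {τ : TieRule V k} {v : V} {E F : Finset (V × V)}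
    (h : F ∈ (step τ v E).support) : ∃ w, F = insert (v, w) E := by
  simp only [step, PMF.mem_support_bind_iff, PMF.support_map, Set.mem_image] at h
  obtain ⟨u, -, w, -, rfl⟩ := h
  exact ⟨w, rfl⟩

/-- A property of the graph that survives each step from a node without out-edges survives a run. -/
lemma run_induction {τ : TieRule V k} {P : Finset (V × V) → Prop}
    (hP : ∀ v w E, P E → (∀ w, (v, w) ∉ E) → P (insert (v, w) E)) {l l' : List V}
    (hl : (l ++ l').Nodup) {E F : Finset (V × V)} (hE : Fresh (l ++ l') E) (h : P E)
    (hF : F ∈ (run τ l E).support) : P F ∧ Fresh l' F := by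
  induction l generalizing E with
  | nil =>
    simp only [run, PMF.support_pure, Set.mem_singleton_iff] at hF
    exact hF ▸ ⟨h, hE⟩
  | cons v l ih =>
    simp only [run, PMF.mem_support_bind_iff] at hF
    obtain ⟨G, hG, hF⟩ := hF
    obtain ⟨w, rfl⟩ := exists_of_mem_support_step hG
    rw [List.cons_append, List.nodup_cons] at hl
    exact ih hl.2 (hE.insert hl.1 w) (hP v w E h (hE v (by simp))) hF

lemma card_le_of_mem_support_run {τ : TieRule V k} {l : List V} {E F : Finset (V × V)}
    (hF : F ∈ (run τ l E).support) : F.card ≤ E.card + l.length := by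
  induction l generalizing E with
  | nil =>
    simp only [run, PMF.support_pure, Set.mem_singleton_iff] at hF
    simp [hF]
  | cons v l ih =>
    simp only [run, PMF.mem_support_bind_iff] at hF
    obtain ⟨G, hG, hF⟩ := hF
    obtain ⟨w, rfl⟩ := exists_of_mem_support_step hG
    have := ih hF
    have := Finset.card_insert_le (v, w) E
    simp only [List.length_cons]
    omega

lemma outDeg_le_one_of_mem_support_run {τ : TieRule V k} {l : List V} (hl : l.Nodup)
    {F : Finset (V × V)} (hF : F ∈ (run τ l ∅).support) (u : V) : outDeg F u ≤ 1 := by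
  refine (run_induction (P := fun F => ∀ u, outDeg F u ≤ 1) (l' := []) ?_ (by simpa using hl)
    (by simp [Fresh]) (by simp [outDeg]) hF).1 u
  intro v w E h hv u
  by_cases huv : v = u
  · subst huv
    have : E.filter (fun e => e.1 = v) = ∅ := by
      ext ⟨a, b⟩
      simp only [Finset.mem_filter, Finset.notMem_empty, iff_false, not_and]
      rintro hab rfl
      exact hv b hab
    simp [outDeg, Finset.filter_insert, this]
  · simpa [outDeg, Finset.filter_insert, huv] using h u

/-- Additive drift, used to count the nodes that enter a level. -/
lemma expect_run_le_add {τ : TieRule V k} {f : Finset (V × V) → ℝ} {c : ℝ}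
    (h : ∀ v E, expect (step τ v E) f ≤ f E + c) (l : List V) (E : Finset (V × V)) :
    expect (run τ l E) f ≤ f E + l.length * c := by
  induction l generalizing E with
  | nil => simp [run, expect_pure]
  | cons v l ih =>
    rw [run, expect_bind]
    calc _ ≤ expect (step τ v E) (fun F => f F + l.length * c) := expect_mono fun F _ => ih F
      _ = expect (step τ v E) f + l.length * c := by rw [expect_add, expect_const]
      _ ≤ _ := by
        have := h v E
        push_cast [List.length_cons]
        linarith

/-- Multiplicative drift, used for exponential moments. The contraction is needed only on graphs
satisfying a property `P` that no edge insertion can destroy. -/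
lemma expect_run_le_pow_mul {τ : TieRule V k} {f : Finset (V × V) → ℝ} {a : ℝ} (ha : 0 ≤ a)
    {P : Finset (V × V) → Prop} (hP : ∀ v w E, P E → P (insert (v, w) E))
    (h : ∀ v E, P E → (∀ w, (v, w) ∉ E) → expect (step τ v E) f ≤ a * f E)
    {l : List V} (hl : l.Nodup) {E : Finset (V × V)} (hE : Fresh l E) (hPE : P E) :
    expect (run τ l E) f ≤ a ^ l.length * f E := by
  induction l generalizing E with
  | nil => simp [run, expect_pure]
  | cons v l ih =>
    rw [List.nodup_cons] at hl
    rw [run, expect_bind]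
    calc _ ≤ expect (step τ v E) (fun F => a ^ l.length * f F) := by
          refine expect_mono fun F hF => ?_
          obtain ⟨w, rfl⟩ := exists_of_mem_support_step hF
          exact ih hl.2 (hE.insert hl.1 w) (hP v w E hPE)
      _ = a ^ l.length * expect (step τ v E) f := expect_const_mul _ _ _
      _ ≤ a ^ l.length * (a * f E) :=
          mul_le_mul_of_nonneg_left (h v E hPE (hE v (by simp))) (pow_nonneg ha _)
      _ = _ := by rw [List.length_cons]; ring

/-- A bound valid for every candidate of least in-degree eliminates the tie rule; all uniformity in
`τ` comes from here. -/
lemma expect_step_le {τ : TieRule V k} {v : V} {E : Finset (V × V)} {f : Finset (V × V) → ℝ}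
    {g : (Fin k → V) → ℝ} (h : ∀ u, ∀ w ∈ argminInDeg E u, f (insert (v, w) E) ≤ g u) :
    expect (step τ v E) f ≤ expect (candidates k v) g := by
  rw [step, expect_bind]
  refine expect_mono fun u _ => ?_
  rw [expect_map, ← expect_const (τ.pick E v u) (g u)]
  exact expect_mono fun w hw => h u w (τ.support_subset E v u hw)

/-- The draws are independent and uniform on the `card V - 1` nodes other than `v`; `v` is erased
from `A` because it is never a candidate. -/
lemma expect_candidates_forall_mem (v : V) (A : Finset V) :
    expect (candidates k v) (fun u => if ∀ j, u j ∈ A then 1 else 0) =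
      ((A.erase v).card / ((Fintype.card V : ℝ) - 1)) ^ k := by
  have hcard : (Fintype.card {w : V // w ≠ v} : ℝ) = (Fintype.card V : ℝ) - 1 := by
    rw [Fintype.card_subtype_compl, Fintype.card_subtype_eq, Nat.cast_sub Fintype.card_pos]
    simp
  have hA : (Finset.univ.filter fun w : {w : V // w ≠ v} => (w : V) ∈ A).card =
      (A.erase v).card := by
    rw [← Finset.card_map (Function.Embedding.subtype _)]
    congr 1
    ext w
    simp [and_comm]
  have hfil : (Finset.univ.filter fun u : Fin k → {w : V // w ≠ v} => ∀ j, (u j : V) ∈ A) =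
      Fintype.piFinset fun _ => Finset.univ.filter fun w : {w : V // w ≠ v} => (w : V) ∈ A := by
    ext u
    simp
  rw [candidates, expect_map, expect]
  simp only [PMF.uniformOfFintype_apply, ENNReal.toReal_inv, ENNReal.toReal_natCast]
  rw [← Finset.mul_sum, Finset.sum_boole, hfil, Fintype.card_piFinset_const, hA,
    Fintype.card_fun, Fintype.card_fin, div_pow, ← hcard]
  push_cast
  field_simp

end Evolution

/-! ### Probability bounds relating consecutive levels, and their iteration. -/

section Layers

lemma card_sub_one_pos {V : Type*} [Fintype V] [Nontrivial V] : 0 < (Fintype.card V : ℝ) - 1 := by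
  have : 1 < Fintype.card V := Fintype.one_lt_card
  rw [sub_pos]
  exact_mod_cast this

variable {V : Type*} [Fintype V] [DecidableEq V] [Nontrivial V] {k : ℕ}

lemma expect_candidates_forall_mem_le (v : V) {A : Finset V} {b : ℝ} (h : (A.card : ℝ) ≤ b) :
    expect (candidates k v) (fun u => if ∀ j, u j ∈ A then 1 else 0) ≤
      (b / ((Fintype.card V : ℝ) - 1)) ^ k := by
  rw [expect_candidates_forall_mem]
  have := card_sub_one_pos (V := V)
  have h2 : ((A.erase v).card : ℝ) ≤ A.card := by exact_mod_cast Finset.card_erase_le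
  gcongr
  exact h2.trans h

/-- It is unlikely that few nodes have in-degree at least `i` in the end, but many have in-degree at
least `i + 1`. -/
lemma mul_prob_card_heavy_succ_le (τ : TieRule V k) (l : List V) (i : ℕ) {b c : ℝ} (hb : 0 ≤ b) :
    c * prob (run τ l ∅) {E | ((heavy E i).card : ℝ) ≤ b ∧ c ≤ (heavy E (i + 1)).card} ≤
      l.length * (b / ((Fintype.card V : ℝ) - 1)) ^ k := by
  have hpos := card_sub_one_pos (V := V)
  -- Truncation makes the drift bound unconditional: level `i` only grows, so once it exceeds `b`
  -- the function stays 0. Before that, level `i + 1` grows only if all candidates lie in level `i`.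
  set f : Finset (V × V) → ℝ := fun E =>
    if ((heavy E i).card : ℝ) ≤ b then ((heavy E (i + 1)).card : ℝ) else 0 with hf
  have h0 : f ∅ = 0 := by simp [hf, heavy, inDeg]
  have hstep : ∀ v E, expect (step τ v E) f ≤ f E + (b / ((Fintype.card V : ℝ) - 1)) ^ k := by
    intro v E
    by_cases hE : ((heavy E i).card : ℝ) ≤ b
    · calc _ ≤ expect (candidates k v) fun u =>
            f E + if ∀ j, u j ∈ heavy E i then 1 else 0 := by
            refine expect_step_le fun u w hw => ?_
            have h1 : f (insert (v, w) E) ≤ ((heavy (insert (v, w) E) (i + 1)).card : ℝ) := by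
              simp only [hf]
              split_ifs
              · exact le_rfl
              · positivity
            refine h1.trans ?_
            have h2 : f E = ((heavy E (i + 1)).card : ℝ) := by simp [hf, hE]
            rw [h2]
            have h3 := card_heavy_insert_le E v w i
            by_cases hi : i ≤ inDeg E w
            · have h4 : ∀ j, u j ∈ heavy E i := fun j => mem_heavy.2 (hi.trans (hw.2 j))
              rw [if_pos h4]
              rw [if_pos hi] at h3
              exact_mod_cast h3
            · rw [if_neg hi] at h3
              have h5 : ((heavy (insert (v, w) E) (i + 1)).card : ℝ) ≤ (heavy E (i + 1)).card := by
                exact_mod_cast h3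
              refine h5.trans (le_add_of_nonneg_right ?_)
              split_ifs <;> norm_num
        _ ≤ _ := by
            rw [expect_add, expect_const]
            gcongr
            exact expect_candidates_forall_mem_le v hE
    · have h1 : f E = 0 := by simp only [hf]; rw [if_neg hE]
      calc _ ≤ expect (candidates k v) fun _ => 0 := by
            refine expect_step_le fun u w _ => ?_
            have h2 : (heavy E i).card ≤ (heavy (insert (v, w) E) i).card :=
              Finset.card_le_card (heavy_mono (Finset.subset_insert _ _) i)
            have h3 : ¬ ((heavy (insert (v, w) E) i).card : ℝ) ≤ b := by
              push Not at hE ⊢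
              exact hE.trans_le (by exact_mod_cast h2)
            simp only [hf]
            rw [if_neg h3]
        _ ≤ _ := by
            rw [expect_const, h1]
            positivity
  calc _ ≤ expect (run τ l ∅) f := by
        refine mul_prob_le_expect (fun E _ => ?_) fun E _ hE => ?_
        · simp only [hf]
          split_ifs <;> positivity
        · simp only [hf]
          rw [if_pos hE.1]
          exact hE.2
    _ ≤ _ := by simpa [h0] using expect_run_le_add hstep l ∅

/-- Union bound over the first level at which the size exceeds its target. Level `s` never does, by
counting edges. -/
lemma prob_lt_card_heavy_le (τ : TieRule V k) (l : List V) (s : ℕ) {b : ℕ → ℝ}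
    (hb : ∀ i, 0 < b i) (h0 : l.length ≤ b 0 * s) (hs : 0 < s) (j : ℕ) :
    prob (run τ l ∅) {E | b j < (heavy E (s + j)).card} ≤
      ∑ i ∈ Finset.range j, l.length * (b i / ((Fintype.card V : ℝ) - 1)) ^ k / b (i + 1) := by
  induction j with
  | zero =>
    have : prob (run τ l ∅) {E | b 0 < (heavy E (s + 0)).card} ≤ prob (run τ l ∅) ∅ := by
      refine prob_mono fun E hE h => ?_
      have h1 := card_le_of_mem_support_run hE
      have h2 := card_heavy_mul_le E s
      simp only [Finset.card_empty, zero_add] at h1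
      have h3 : ((heavy E s).card : ℝ) * s ≤ l.length := by exact_mod_cast h2.trans h1
      have h4 : (0 : ℝ) < s := by exact_mod_cast hs
      have h5 : b 0 < (heavy E s).card := h
      nlinarith
    simpa [prob] using this
  | succ j ih =>
    rw [Finset.sum_range_succ]
    calc _ ≤ prob (run τ l ∅) ({E | b j < (heavy E (s + j)).card} ∪
          {E | ((heavy E (s + j)).card : ℝ) ≤ b j ∧ b (j + 1) ≤ (heavy E (s + j + 1)).card}) := by
          refine prob_mono fun E _ hE => ?_
          rcases lt_or_ge (b j) ((heavy E (s + j)).card : ℝ) with h | h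
          · exact Or.inl h
          · exact Or.inr ⟨h, le_of_lt hE⟩
      _ ≤ _ := prob_union_le _ _ _
      _ ≤ _ := by
          gcongr
          rw [le_div_iff₀' (hb _)]
          exact mul_prob_card_heavy_succ_le τ l _ (hb j).le

/-- Upper bound for the maximal in-degree with at least two choices. -/
lemma prob_heavy_nonempty_le {n : ℕ} [Nontrivial (Fin n)] (hk : 2 ≤ k) (τ : TieRule (Fin n) k)
    {M : ℝ} (hM : 1 ≤ M) {s : ℕ} (hs : 16 * M ≤ s) {j : ℕ} (hj : n ≤ 2 ^ k ^ j) :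
    prob (kApproxLine τ) {E | (heavy E (s + j)).Nonempty} ≤ 2 / M := by
  have hn : 2 ≤ n := Fin.nontrivial_iff_two_le.1 inferInstance
  have hn' : (2 : ℝ) ≤ n := by exact_mod_cast hn
  have hn1 : (0 : ℝ) < n - 1 := by linarith
  have hM0 : 0 < M := by linarith
  -- The `k`-th power turns `(1 / 2) ^ k ^ i` into the next one exactly. The factor `4 * M * 2 ^ i`
  -- is raised to a power at least 2, but only its successor is divided out, so the failure
  -- probabilities are at most `1 / M * (1 / 2) ^ i`, which is summable.
  set b : ℕ → ℝ := fun i => (n - 1) * ((1 / 2) ^ k ^ i / (4 * M * 2 ^ i)) with hb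
  have hb0 : ∀ i, 0 < b i := fun i => by positivity
  have hs0 : (0 : ℝ) < s := by linarith
  have hlen : ((List.finRange n).length : ℝ) ≤ b 0 * s := by
    have h1 : b 0 * s = (n - 1) * s / (8 * M) := by
      simp only [hb, pow_zero, pow_one]
      field_simp
      ring
    rw [h1, le_div_iff₀ (by positivity), List.length_finRange]
    nlinarith
  have hlast : b j < 1 := by
    have h1 : (n : ℝ) ≤ 2 ^ k ^ j := by exact_mod_cast hj
    have h2 : (1 : ℝ) ≤ 2 ^ j := one_le_pow₀ (by norm_num)
    have h3 : (4 : ℝ) ≤ 4 * M * 2 ^ j := by nlinarith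
    have h4 : (0 : ℝ) < 2 ^ k ^ j := by positivity
    simp only [hb, one_div, inv_pow]
    rw [inv_eq_one_div, div_div, mul_one_div, div_lt_one (by positivity)]
    nlinarith
  have hterm : ∀ i, ((List.finRange n).length : ℝ) *
      (b i / ((Fintype.card (Fin n) : ℝ) - 1)) ^ k / b (i + 1) ≤ 1 / M * (1 / 2) ^ i := by
    intro i
    have h1 : b i / ((Fintype.card (Fin n) : ℝ) - 1) = (1 / 2) ^ k ^ i / (4 * M * 2 ^ i) := by
      simp only [hb, Fintype.card_fin]
      field_simp
    have h2 : (1 : ℝ) ≤ 2 ^ i := one_le_pow₀ (by norm_num)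
    have h3 : (4 * M * 2 ^ i) ^ 2 ≤ (4 * M * 2 ^ i) ^ k :=
      pow_le_pow_right₀ (by nlinarith) hk
    have h4 : (0 : ℝ) < (1 / 2) ^ k ^ (i + 1) := by positivity
    rw [h1, div_pow, ← pow_mul, ← pow_succ, List.length_finRange, div_le_iff₀ (hb0 _)]
    simp only [hb]
    calc (n : ℝ) * ((1 / 2) ^ k ^ (i + 1) / (4 * M * 2 ^ i) ^ k)
        ≤ (2 * (n - 1)) * ((1 / 2) ^ k ^ (i + 1) / (4 * M * 2 ^ i) ^ 2) := by
          gcongr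
          linarith
      _ = _ := by
          rw [pow_succ 2 i, div_pow 1 2 i]
          field_simp
          ring
  rw [kApproxLine_eq_run]
  calc _ ≤ prob (run τ (List.finRange n) ∅) {E | b j < (heavy E (s + j)).card} := by
        refine prob_mono fun E _ hE => hlast.trans_le ?_
        exact_mod_cast Finset.Nonempty.card_pos hE
    _ ≤ _ := prob_lt_card_heavy_le τ _ s hb0 hlen (by exact_mod_cast hs0) j
    _ ≤ ∑ i ∈ Finset.range j, 1 / M * (1 / 2) ^ i := Finset.sum_le_sum fun i _ => hterm i
    _ = 1 / M * ∑ i ∈ Finset.range j, (1 / 2) ^ i := by rw [Finset.mul_sum]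
    _ ≤ 1 / M * 2 := by
        gcongr
        exact sum_geometric_two_le j
    _ = _ := by ring

/-- Upper bound for the maximal in-degree without choice. -/
lemma rpow_mul_prob_exists_inDeg_le {n : ℕ} [Nontrivial (Fin n)] (τ : TieRule (Fin n) 1) {x : ℝ}
    (hx : 1 ≤ x) (s : ℝ) :
    x ^ s * prob (kApproxLine τ) {E | ∃ u, s ≤ inDeg E u} ≤ n * Real.exp (2 * x) := by
  have hn : 2 ≤ n := Fin.nontrivial_iff_two_le.1 inferInstance
  have hn' : (2 : ℝ) ≤ n := by exact_mod_cast hn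
  have hn1 : (0 : ℝ) < n - 1 := by linarith
  have hx0 : 0 < x := by linarith
  -- With one candidate each node is hit with probability at most `1 / (n - 1)`, so a step
  -- multiplies the mean of `f` by at most `1 + (x - 1) / (n - 1)`.
  set f : Finset (Fin n × Fin n) → ℝ := fun E => ∑ u, x ^ inDeg E u with hf
  have h0 : f ∅ = n := by simp [hf, inDeg]
  have ha : 0 ≤ 1 + (x - 1) / (n - 1) := by
    have := div_nonneg (sub_nonneg.2 hx) hn1.le
    linarith
  have hstep : ∀ v E, expect (step τ v E) f ≤ (1 + (x - 1) / (n - 1)) * f E := by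
    intro v E
    calc _ ≤ expect (candidates 1 v) fun u => ∑ y, (x ^ inDeg E y +
          (x - 1) * x ^ inDeg E y * if ∀ j, u j ∈ ({y} : Finset (Fin n)) then 1 else 0) := by
          refine expect_step_le fun u w hw => Finset.sum_le_sum fun y _ => ?_
          obtain ⟨j, rfl⟩ := hw.1
          have h1 := inDeg_insert_le E v (u j) y
          by_cases h : u j = y
          · have h2 : ∀ i, u i ∈ ({y} : Finset (Fin n)) := fun i => by
              rw [Subsingleton.elim i j, h, Finset.mem_singleton]
            rw [if_pos h] at h1
            rw [if_pos h2]
            calc _ ≤ x ^ (inDeg E y + 1) := pow_le_pow_right₀ hx h1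
              _ = _ := by ring
          · rw [if_neg h] at h1
            have h2 : 0 ≤ (x - 1) * x ^ inDeg E y :=
              mul_nonneg (sub_nonneg.2 hx) (by positivity)
            refine (pow_le_pow_right₀ hx h1).trans (le_add_of_nonneg_right (mul_nonneg h2 ?_))
            split_ifs <;> norm_num
      _ = ∑ y, (x ^ inDeg E y + (x - 1) * x ^ inDeg E y *
          expect (candidates 1 v) fun u => if ∀ j, u j ∈ ({y} : Finset (Fin n)) then 1 else 0) := by
          rw [expect_sum]
          refine Finset.sum_congr rfl fun y _ => ?_
          rw [expect_add, expect_const, expect_const_mul]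
      _ ≤ ∑ y, (x ^ inDeg E y + (x - 1) * x ^ inDeg E y * (1 / (n - 1))) := by
          refine Finset.sum_le_sum fun y _ => ?_
          have h2 : 0 ≤ (x - 1) * x ^ inDeg E y :=
            mul_nonneg (sub_nonneg.2 hx) (by positivity)
          have h3 := expect_candidates_forall_mem_le (k := 1) v (A := {y}) (b := 1) (by simp)
          rw [pow_one, Fintype.card_fin] at h3
          gcongr
      _ = _ := by
          simp only [hf, Finset.mul_sum]
          exact Finset.sum_congr rfl fun y _ => by ring
  rw [kApproxLine_eq_run]
  calc _ ≤ expect (run τ (List.finRange n) ∅) f := by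
        refine mul_prob_le_expect (fun E _ => ?_) fun E _ hE => ?_
        · exact Finset.sum_nonneg fun u _ => by positivity
        · obtain ⟨u, hu⟩ := hE
          calc x ^ s ≤ x ^ (inDeg E u : ℝ) := Real.rpow_le_rpow_of_exponent_le hx hu
            _ = x ^ inDeg E u := Real.rpow_natCast _ _
            _ ≤ f E := Finset.single_le_sum (f := fun u => x ^ inDeg E u)
              (fun u _ => by positivity) (Finset.mem_univ u)
    _ ≤ (1 + (x - 1) / (n - 1)) ^ (List.finRange n).length * f ∅ :=
        expect_run_le_pow_mul (P := fun _ => True) ha (fun _ _ _ _ => trivial)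
          (fun v E _ _ => hstep v E) (List.nodup_finRange n) (by simp [Fresh]) trivial
    _ ≤ Real.exp (2 * x) * n := by
        rw [h0, List.length_finRange]
        gcongr
        calc (1 + (x - 1) / (n - 1)) ^ n ≤ Real.exp ((x - 1) / (n - 1)) ^ n := by
              gcongr
              rw [add_comm]
              exact Real.add_one_le_exp _
          _ = Real.exp (n * ((x - 1) / (n - 1))) := by rw [Real.exp_nat_mul]
          _ ≤ _ := by
              rw [Real.exp_le_exp, mul_div_assoc', div_le_iff₀ hn1]
              nlinarith
    _ = _ := mul_comm _ _

/-- During a phase that starts with many nodes of in-degree at least `i`, the number of nodes of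
in-degree at least `i + 1` is unlikely to stay small. -/
lemma prob_card_heavy_succ_lt_le (τ : TieRule V k) {l : List V} (hl : l.Nodup)
    {E : Finset (V × V)} (hE : Fresh l E) {i : ℕ} {b c p : ℝ} (hb : 1 ≤ b)
    (hbE : b ≤ (heavy E i).card) (hp1 : p ≤ 1)
    (hp : p + (c / ((Fintype.card V : ℝ) - 1)) ^ k ≤ ((b - 1) / ((Fintype.card V : ℝ) - 1)) ^ k) :
    prob (run τ l E) {F | ((heavy F (i + 1)).card : ℝ) < c} ≤
      (2 : ℝ) ^ c * (1 - p / 2) ^ l.length := by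
  have hpos := card_sub_one_pos (V := V)
  -- An exponential moment of the deficit, killed once level `i + 1` reaches `c`. Until then a step
  -- halves it with probability at least `p`, whence the factor `1 - p / 2`.
  set f : Finset (V × V) → ℝ := fun F =>
    if ((heavy F (i + 1)).card : ℝ) < c then (1 / 2) ^ (heavy F (i + 1)).card else 0 with hf
  have hf0 : ∀ F, 0 ≤ f F := fun F => by
    simp only [hf]
    split_ifs <;> positivity
  have hf1 : ∀ F, f F ≤ 1 := fun F => by
    simp only [hf]
    split_ifs
    · exact pow_le_one₀ (by norm_num) (by norm_num)
    · norm_num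
  have hstep : ∀ v F, b ≤ (heavy F i).card → (∀ w, (v, w) ∉ F) →
      expect (step τ v F) f ≤ (1 - p / 2) * f F := by
    intro v F hF hv
    have hmono : ∀ w, (heavy F (i + 1)).card ≤ (heavy (insert (v, w) F) (i + 1)).card :=
      fun w => Finset.card_le_card (heavy_mono (Finset.subset_insert _ _) _)
    have hanti : ∀ w m, (heavy F (i + 1)).card + m ≤ (heavy (insert (v, w) F) (i + 1)).card →
        f (insert (v, w) F) ≤ f F * (1 / 2) ^ m := by
      intro w m hm
      by_cases h1 : ((heavy (insert (v, w) F) (i + 1)).card : ℝ) < c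
      · have h2 : ((heavy F (i + 1)).card : ℝ) < c :=
          lt_of_le_of_lt (by exact_mod_cast hmono w) h1
        simp only [hf]
        rw [if_pos h1, if_pos h2, ← pow_add]
        exact pow_le_pow_of_le_one (by norm_num) (by norm_num) hm
      · have h3 : f (insert (v, w) F) = 0 := by simp only [hf]; rw [if_neg h1]
        rw [h3]
        exact mul_nonneg (hf0 F) (by positivity)
    by_cases hc : ((heavy F (i + 1)).card : ℝ) < c
    · calc _ ≤ expect (candidates k v) (fun u => f F + (f F / 2 *
            (if ∀ j, u j ∈ heavy F (i + 1) then 1 else 0) + -(f F / 2) *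
              if ∀ j, u j ∈ heavy F i then 1 else 0)) := by
            refine expect_step_le fun u w hw => ?_
            by_cases hA : ∀ j, u j ∈ heavy F i
            · by_cases hA' : ∀ j, u j ∈ heavy F (i + 1)
              · rw [if_pos hA, if_pos hA']
                have := hanti w 0 (hmono w)
                linarith
              · rw [if_pos hA, if_neg hA']
                push Not at hA'
                obtain ⟨j, hj⟩ := hA'
                obtain ⟨⟨j', rfl⟩, hw⟩ := hw
                have h1 := mem_heavy.1 (hA j')
                have h2 := hw j
                rw [mem_heavy] at hj
                -- All candidates have in-degree at least `i` and one has exactly `i`, so the chosen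
                -- node has exactly `i` and is promoted.
                have := hanti (u j') 1 (card_heavy_insert_of_inDeg_eq (hv _) (by omega))
                linarith
            · have hA' : ¬ ∀ j, u j ∈ heavy F (i + 1) := fun h =>
                hA fun j => heavy_anti F (Nat.le_succ i) (h j)
              rw [if_neg hA, if_neg hA']
              have := hanti w 0 (hmono w)
              linarith
        _ ≤ f F + (f F / 2 * (c / ((Fintype.card V : ℝ) - 1)) ^ k +
              -(f F / 2) * ((b - 1) / ((Fintype.card V : ℝ) - 1)) ^ k) := by
            rw [expect_add, expect_add, expect_const, expect_const_mul, expect_const_mul]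
            have h1 := expect_candidates_forall_mem_le (k := k) v hc.le
            have h2 : ((b - 1) / ((Fintype.card V : ℝ) - 1)) ^ k ≤ expect (candidates k v)
                (fun u => if ∀ j, u j ∈ heavy F i then 1 else 0) := by
              -- Erasing `v` can cost level `i` one node; hence `b - 1`.
              rw [expect_candidates_forall_mem]
              have h3 : (heavy F i).card ≤ ((heavy F i).erase v).card + 1 :=
                Nat.sub_le_iff_le_add.1 Finset.pred_card_le_card_erase
              have h4 : ((heavy F i).card : ℝ) ≤ ((heavy F i).erase v).card + 1 := by
                exact_mod_cast h3
              have h5 : 0 ≤ b - 1 := by linarith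
              gcongr
              linarith
            have h6 : 0 ≤ f F / 2 := by linarith [hf0 F]
            have := mul_le_mul_of_nonneg_left h1 h6
            have := mul_le_mul_of_nonneg_left h2 h6
            linarith
        _ ≤ _ := by
            have h6 : 0 ≤ f F / 2 := by linarith [hf0 F]
            have := mul_le_mul_of_nonneg_left hp h6
            linarith
    · have h1 : f F = 0 := by simp only [hf]; rw [if_neg hc]
      calc _ ≤ expect (candidates k v) fun _ => 0 := by
            refine expect_step_le fun u w _ => ?_
            simpa [h1] using hanti w 0 (hmono w)
        _ = _ := by rw [expect_const, h1, mul_zero]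
  have hrun : expect (run τ l E) f ≤ (1 - p / 2) ^ l.length * f E :=
    expect_run_le_pow_mul (P := fun F => b ≤ (heavy F i).card) (by linarith)
      (fun v w F hF => hF.trans (by
        exact_mod_cast Finset.card_le_card (heavy_mono (Finset.subset_insert _ _) _)))
      hstep hl hE hbE
  have hmarkov : (2 : ℝ) ^ (-c) * prob (run τ l E) {F | ((heavy F (i + 1)).card : ℝ) < c} ≤
      expect (run τ l E) f := by
    refine mul_prob_le_expect (fun F _ => hf0 F) fun F _ hF => ?_
    have hF' : ((heavy F (i + 1)).card : ℝ) < c := hF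
    simp only [hf]
    rw [if_pos hF', one_div, inv_pow, ← Real.rpow_natCast, ← Real.rpow_neg (by norm_num)]
    exact Real.rpow_le_rpow_of_exponent_le (by norm_num) (by linarith)
  rw [Real.rpow_neg (by norm_num), inv_mul_le_iff₀ (by positivity)] at hmarkov
  refine hmarkov.trans ?_
  gcongr
  refine hrun.trans (mul_le_of_le_one_right (pow_nonneg (by linarith) _) (hf1 E))

/-- One phase of at least `T` nodes per level, each failing with probability at most `q` given that
the earlier ones succeeded. -/
lemma prob_card_heavy_lt_le (τ : TieRule V k) {m T : ℕ} {b p : ℕ → ℝ} {q : ℝ}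
    (hb0 : b 0 ≤ Fintype.card V) (hb : ∀ i < m, 1 ≤ b i) (hp0 : ∀ i < m, 0 ≤ p i)
    (hp1 : ∀ i < m, p i ≤ 1)
    (hp : ∀ i < m, p i + (b (i + 1) / ((Fintype.card V : ℝ) - 1)) ^ k ≤
      ((b i - 1) / ((Fintype.card V : ℝ) - 1)) ^ k)
    (hq : ∀ i < m, (2 : ℝ) ^ b (i + 1) * (1 - p i / 2) ^ T ≤ q) {i : ℕ} (him : i ≤ m)
    {l : List V} (hl : l.Nodup) (hlen : i * T ≤ l.length) :
    prob (run τ l ∅) {E | ((heavy E i).card : ℝ) < b i} ≤ i * q := by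
  induction i generalizing l with
  | zero =>
    have : prob (run τ l ∅) {E | ((heavy E 0).card : ℝ) < b 0} ≤ prob (run τ l ∅) ∅ := by
      refine prob_mono fun E _ h => ?_
      have h1 : ((heavy E 0).card : ℝ) < b 0 := h
      have h2 : heavy E 0 = Finset.univ := by ext; simp
      rw [h2, Finset.card_univ] at h1
      linarith
    simpa [prob] using this
  | succ i ih =>
    have hi : i < m := him
    have h2b : 0 ≤ 1 - p i / 2 := by linarith [hp1 i hi]
    have hq0 : 0 ≤ q := le_trans (by positivity) (hq i hi)
    have h1 : (l.take (i * T)).length = i * T := by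
      rw [List.length_take, min_eq_left]
      exact le_trans (Nat.mul_le_mul_right T (Nat.le_succ i)) hlen
    have h2 : T ≤ (l.drop (i * T)).length := by
      rw [List.length_drop]
      rw [Nat.succ_mul] at hlen
      omega
    have hsplit := List.take_append_drop (i * T) l
    rw [← hsplit, run_append]
    calc _ ≤ prob (run τ (l.take (i * T)) ∅) {E | ((heavy E i).card : ℝ) < b i} + q := by
          refine prob_bind_le hq0 fun E hE hEi => ?_
          have hfresh : Fresh (l.drop (i * T)) E :=
            (run_induction (P := fun _ => True) (fun _ _ _ _ _ => trivial)
              (by rw [hsplit]; exact hl) (by simp [Fresh]) trivial hE).2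
          refine (prob_card_heavy_succ_lt_le τ (hl.sublist (List.drop_sublist _ _)) hfresh
            (hb i hi) (not_lt.1 hEi) (hp1 i hi) (hp i hi)).trans (le_trans ?_ (hq i hi))
          gcongr ?_ * ?_
          exact pow_le_pow_of_le_one h2b (by linarith [hp0 i hi]) h2
      _ ≤ i * q + q := by
          gcongr
          exact ih hi.le (hl.sublist (List.take_sublist _ _)) h1.ge
      _ = _ := by push_cast; ring

end Layers

/-! ### Choice of parameters and passage to the limit. -/

section Asymptotics

variable {k : ℕ}

/-- Lower bound for the maximal in-degree. -/
lemma prob_heavy_eq_empty_le {n : ℕ} [Nontrivial (Fin n)] (hk : 1 ≤ k) (τ : TieRule (Fin n) k)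
    {m : ℕ} (hm : 1 ≤ m)
    (h4 : 4 * (2 ^ (k + 3) * m : ℝ) ^ (∑ j ∈ Finset.range m, k ^ j) ≤ n) :
    prob (kApproxLine τ) {E | heavy E m = ∅} ≤
      m * (2 ^ (k + 3) * m : ℝ) ^ (∑ j ∈ Finset.range m, k ^ j) / n := by
  have hn : 2 ≤ n := Fin.nontrivial_iff_two_le.1 inferInstance
  have hn' : (2 : ℝ) ≤ n := by exact_mod_cast hn
  have hn1 : (0 : ℝ) < n - 1 := by linarith
  have hm' : (1 : ℝ) ≤ m := by exact_mod_cast hm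
  -- Chosen so that in a phase of at least `n / (2 * m)` nodes, with `p = (x i / 2) ^ k`, the
  -- exponent `p / 2 * T` is at least twice the target `n * x (i + 1)`.
  set D : ℝ := 2 ^ (k + 3) * m with hD
  have hD16 : 4 ≤ D := by
    have : (2 : ℝ) ^ 2 ≤ 2 ^ (k + 3) := pow_le_pow_right₀ (by norm_num) (by omega)
    nlinarith
  have hD0 : 0 < D := by linarith
  set S : ℕ → ℕ := fun i => ∑ j ∈ Finset.range i, k ^ j with hS
  have hSsucc : ∀ i, S (i + 1) = S i * k + 1 := fun i => by
    rw [mul_comm]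
    exact geom_sum_succ
  have hSmono : Monotone S := fun i j hij =>
    Finset.sum_le_sum_of_subset (Finset.range_subset_range.2 hij)
  set x : ℕ → ℝ := fun i => D⁻¹ ^ S i with hx
  have hx0 : ∀ i, 0 < x i := fun i => by positivity
  have hx1 : ∀ i, x i ≤ 1 := fun i =>
    pow_le_one₀ (by positivity) (inv_le_one_of_one_le₀ (by linarith))
  have hxsucc : ∀ i, x (i + 1) = x i ^ k / D := fun i => by
    simp only [hx]
    rw [hSsucc, pow_succ, pow_mul, div_eq_mul_inv]
  have hxk : ∀ i, x i ^ k ≤ x i := fun i => pow_le_of_le_one (hx0 i).le (hx1 i) (by omega)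
  have hxquarter : ∀ i, x (i + 1) ≤ x i / 4 := fun i => by
    rw [hxsucc]
    exact div_le_div₀ (hx0 i).le (hxk i) (by norm_num) hD16
  have hxm : ∀ i ≤ m, x m ≤ x i := fun i hi =>
    pow_le_pow_of_le_one (by positivity) (inv_le_one_of_one_le₀ (by linarith)) (hSmono hi)
  have hnxm : 4 ≤ n * x m := by
    simp only [hx, inv_pow]
    rw [← div_eq_mul_inv, le_div_iff₀ (by positivity)]
    exact h4
  have hmn : m ≤ n := by
    have h1 : D ≤ D ^ S m := by
      refine le_self_pow₀ (by linarith) ?_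
      obtain ⟨i, rfl⟩ : ∃ i, m = i + 1 := ⟨m - 1, by omega⟩
      rw [hSsucc]
      omega
    have h2 : (1 : ℝ) ≤ 2 ^ (k + 3) := one_le_pow₀ (by norm_num)
    have h3 : (m : ℝ) ≤ n := by
      have h5 : 4 * D ^ S m ≤ n := h4
      nlinarith
    exact_mod_cast h3
  have hT : (n : ℝ) / (2 * m) ≤ (n / m : ℕ) := by
    have h1 : n < m * (n / m + 1) := Nat.lt_mul_div_succ n (by omega)
    have h2 : 1 ≤ n / m := (Nat.one_le_div_iff (by omega)).2 hmn
    have h3 : n ≤ 2 * m * (n / m) := by nlinarith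
    rw [div_le_iff₀ (by positivity)]
    have h4 : (n : ℝ) ≤ 2 * m * (n / m : ℕ) := by exact_mod_cast h3
    linarith
  have hp1 : ∀ i, (x i / 2) ^ k ≤ 1 := fun i =>
    pow_le_one₀ (by linarith [hx0 i]) (by linarith [hx0 i, hx1 i])
  have main : prob (kApproxLine τ) {E | ((heavy E m).card : ℝ) < n * x m} ≤
      m * Real.exp (-(n * x m)) := by
    rw [kApproxLine_eq_run]
    refine prob_card_heavy_lt_le τ (m := m) (T := n / m) (b := fun i => n * x i)
      (p := fun i => (x i / 2) ^ k) (by simp [hx, hS]) (fun i hi => ?_)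
      (fun i _ => by have := hx0 i; positivity) (fun i _ => hp1 i) (fun i hi => ?_)
      (fun i hi => ?_) le_rfl (List.nodup_finRange n) ?_
    · have := mul_le_mul_of_nonneg_left (hxm i hi.le) (by linarith : (0 : ℝ) ≤ n)
      linarith
    · have hge : 4 ≤ n * x i := by
        have := mul_le_mul_of_nonneg_left (hxm i hi.le) (by linarith : (0 : ℝ) ≤ n)
        linarith
      rw [Fintype.card_fin]
      have h1 : x i / 2 ≤ n * x i / 2 / (n - 1) := by
        rw [le_div_iff₀ hn1]
        nlinarith [hx0 i]
      have h2 : n * x (i + 1) ≤ n * x i / 4 := by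
        have := mul_le_mul_of_nonneg_left (hxquarter i) (by linarith : (0 : ℝ) ≤ n)
        linarith
      have h3 := (hx0 (i + 1)).le
      have h5 := (hx0 i).le
      -- As `n * x i ≥ 4`, subtracting 1 leaves at least `3/4 = 1/2 + 1/4` of it, and `t ↦ t ^ k` is
      -- superadditive.
      calc _ ≤ (n * x i / 2 / (n - 1)) ^ k + (n * x i / 4 / (n - 1)) ^ k := by gcongr
        _ ≤ (n * x i / 2 / (n - 1) + n * x i / 4 / (n - 1)) ^ k :=
            pow_add_pow_le (by positivity) (by positivity) (by omega)
        _ ≤ _ := by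
            rw [← add_div]
            gcongr
            linarith
    · have h1 : 2 * (n * x (i + 1)) ≤ (x i / 2) ^ k / 2 * (n / m : ℕ) := by
        calc _ = (x i / 2) ^ k / 2 * ((n : ℝ) / (2 * m)) := by
              rw [hxsucc, hD, div_pow, pow_add]
              field_simp
          _ ≤ _ := by
              have := (hx0 i).le
              gcongr
      have h2 : (2 : ℝ) ^ (n * x (i + 1)) ≤ Real.exp (n * x (i + 1)) := by
        rw [Real.rpow_def_of_pos (by norm_num), Real.exp_le_exp]
        have := Real.log_two_lt_d9
        have h3 : 0 ≤ n * x (i + 1) := by have := (hx0 (i + 1)).le; positivity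
        nlinarith
      have h3 : (1 - (x i / 2) ^ k / 2) ^ (n / m) ≤
          Real.exp (-((x i / 2) ^ k / 2 * (n / m : ℕ))) := by
        rw [← neg_mul, mul_comm, Real.exp_nat_mul]
        have := hp1 i
        gcongr
        · linarith
        · linarith [Real.add_one_le_exp (-((x i / 2) ^ k / 2))]
      have h6 := mul_le_mul_of_nonneg_left (hxm (i + 1) hi) (by linarith : (0 : ℝ) ≤ n)
      have := hp1 i
      calc _ ≤ Real.exp (n * x (i + 1)) * Real.exp (-((x i / 2) ^ k / 2 * (n / m : ℕ))) :=
            mul_le_mul h2 h3 (pow_nonneg (by linarith) _) (Real.exp_pos _).le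
        _ ≤ _ := by
            rw [← Real.exp_add, Real.exp_le_exp]
            linarith
    · rw [List.length_finRange]
      exact Nat.mul_div_le n m
  calc _ ≤ prob (kApproxLine τ) {E | ((heavy E m).card : ℝ) < n * x m} := by
        refine prob_mono fun E _ hE => ?_
        have hE' : heavy E m = ∅ := hE
        simp only [Set.mem_ofPred_eq, hE', Finset.card_empty, Nat.cast_zero]
        linarith
    _ ≤ m * Real.exp (-(n * x m)) := main
    _ ≤ m * (n * x m)⁻¹ := by
        rw [Real.exp_neg]
        gcongr
        linarith [Real.add_one_le_exp (n * x m)]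
    _ = _ := by
        simp only [hx, hS, inv_pow, mul_inv, inv_inv]
        field_simp

/-- The leading term as a function of `log n`. -/
noncomputable def leadingFun (k : ℕ) (y : ℝ) : ℝ :=
  if k = 1 then y / Real.log y else Real.log y / Real.log k

lemma leadingTerm_eq (k n : ℕ) : leadingTerm k n = leadingFun k (Real.log n) := rfl

lemma eventually_log_le_mul {c : ℝ} (hc : 0 < c) : ∀ᶠ y : ℝ in atTop, Real.log y ≤ c * y := by
  filter_upwards [Real.isLittleO_log_id_atTop.bound hc, eventually_ge_atTop 0] with y h hy
  simpa [abs_of_nonneg hy] using (le_abs_self _).trans h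

lemma tendsto_leadingFun (hk : 1 ≤ k) : Tendsto (leadingFun k) atTop atTop := by
  unfold leadingFun
  split_ifs with h
  · refine tendsto_atTop.2 fun b => ?_
    have hb : 0 < (|b| + 1)⁻¹ := by positivity
    filter_upwards [eventually_log_le_mul hb, Real.tendsto_log_atTop.eventually_gt_atTop 0]
      with y hy hpos
    rw [le_div_iff₀ hpos]
    rw [inv_mul_eq_div, le_div_iff₀' (by positivity)] at hy
    nlinarith [le_abs_self b]
  · refine Real.tendsto_log_atTop.atTop_div_const (Real.log_pos ?_)
    exact_mod_cast (by omega : 1 < k)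

lemma tendsto_log_natCast : Tendsto (fun n : ℕ => Real.log n) atTop atTop :=
  Real.tendsto_log_atTop.comp tendsto_natCast_atTop_atTop

/-- With `y = log n` this is the size condition of the lower bound; the `+ 1` absorbs the prefactor
`m`. For `k = 1` the left side is at most `(m + 1) * log y`, and `m * log y ≤ (1 - ε) * y`. For `k >
1` the geometric sum plus 1 is at most `k ^ m ≤ y ^ (1 - ε)`, while the logarithm is at most `y ^ ε
/ 2`. -/
lemma eventually_mul_log_le (hk : 1 ≤ k) {ε : ℝ} (hε : 0 < ε) (hε1 : ε < 1) (K : ℝ) :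
    ∀ᶠ y : ℝ in atTop, ∀ m : ℕ, 1 ≤ m → m ≤ (1 - ε) * leadingFun k y →
      ((∑ j ∈ Finset.range m, k ^ j : ℕ) + 1) * Real.log (2 ^ (k + 3) * m) ≤ y - K := by
  by_cases hk1 : k = 1
  · subst hk1
    filter_upwards [eventually_log_le_mul (half_pos hε), eventually_ge_atTop (2 * K / ε),
      Real.tendsto_log_atTop.eventually_ge_atTop 16, eventually_gt_atTop 0]
      with y h1 h2 h3 h4 m hm hmy
    have hm0 : (1 : ℝ) ≤ m := by exact_mod_cast hm
    have hL : 0 < Real.log y := by linarith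
    simp only [leadingFun, if_true] at hmy
    have h5 : m * Real.log y ≤ (1 - ε) * y := by
      rwa [← mul_div_assoc, le_div_iff₀ hL] at hmy
    have h6 : Real.log (2 ^ (1 + 3) * m) ≤ Real.log y := by
      refine Real.log_le_log (by positivity) ?_
      have h7 : 16 * (m : ℝ) ≤ m * Real.log y := by nlinarith
      have h8 := mul_pos hε h4
      norm_num
      linarith
    rw [div_le_iff₀ hε] at h2
    simp only [one_pow, Finset.sum_const, Finset.card_range, smul_eq_mul, mul_one]
    calc _ ≤ ((m : ℝ) + 1) * Real.log y := by gcongr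
      _ ≤ _ := by nlinarith
  · have hk2 : 2 ≤ k := by omega
    have hlk : 0 < Real.log k := Real.log_pos (by exact_mod_cast (by omega : 1 < k))
    have hc : 0 < Real.log k / (2 ^ (k + 3) * 2) := by positivity
    filter_upwards [(isLittleO_log_rpow_atTop hε).bound hc, eventually_ge_atTop (2 * K),
      Real.tendsto_log_atTop.eventually_gt_atTop 0, eventually_gt_atTop 0]
      with y h1 h2 h3 h4 m hm hmy
    have hm0 : (1 : ℝ) ≤ m := by exact_mod_cast hm
    rw [Real.norm_eq_abs, Real.norm_eq_abs, abs_of_pos h3,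
      abs_of_pos (Real.rpow_pos_of_pos h4 _)] at h1
    simp only [leadingFun, if_neg hk1] at hmy
    have h5 : m * Real.log k ≤ (1 - ε) * Real.log y := by
      rwa [← mul_div_assoc, le_div_iff₀ hlk] at hmy
    have h6 : ((∑ j ∈ Finset.range m, k ^ j : ℕ) + 1 : ℝ) ≤ y ^ (1 - ε) := by
      have h7 : ∑ j ∈ Finset.range m, k ^ j + 1 ≤ k ^ m :=
        Nat.geomSum_lt hk2 fun j hj => Finset.mem_range.1 hj
      calc _ ≤ ((k : ℝ) ^ m) := by exact_mod_cast h7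
        _ = Real.exp (m * Real.log k) := by
            rw [Real.exp_nat_mul, Real.exp_log (by exact_mod_cast hk)]
        _ ≤ Real.exp ((1 - ε) * Real.log y) := Real.exp_le_exp.2 h5
        _ = _ := by rw [Real.rpow_def_of_pos h4, mul_comm]
    have h8 : Real.log (2 ^ (k + 3) * m) ≤ y ^ ε / 2 := by
      have h9 : 2 ^ (k + 3) * (m : ℝ) ≤ 2 ^ (k + 3) * (Real.log y / Real.log k) := by
        gcongr
        rw [le_div_iff₀ hlk]
        nlinarith
      calc _ ≤ 2 ^ (k + 3) * (m : ℝ) := Real.log_le_self (by positivity)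
        _ ≤ 2 ^ (k + 3) * (Real.log y / Real.log k) := h9
        _ ≤ 2 ^ (k + 3) * (Real.log k / (2 ^ (k + 3) * 2) * y ^ ε / Real.log k) := by gcongr
        _ = _ := by field_simp
    have h10 : 0 ≤ Real.log (2 ^ (k + 3) * m) :=
      Real.log_nonneg (one_le_mul_of_one_le_of_one_le (one_le_pow₀ (by norm_num)) hm0)
    calc _ ≤ y ^ (1 - ε) * (y ^ ε / 2) := by gcongr
      _ = y / 2 := by
          rw [← mul_div_assoc, ← Real.rpow_add h4]
          norm_num
      _ ≤ _ := by linarith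

/-- Some node has in-degree close to the leading term. -/
lemma eventually_prob_forall_inDeg_lt_le (hk : 1 ≤ k) {ε : ℝ} (hε : 0 < ε) (hε1 : ε < 1) :
    ∀ᶠ n : ℕ in atTop, ∀ [Nontrivial (Fin n)] (τ : TieRule (Fin n) k),
      prob (kApproxLine τ) {E | ∀ u, (inDeg E u : ℝ) < (1 - ε) * leadingTerm k n - 1} ≤ ε := by
  -- `1 / 4` serves the hypothesis of `prob_heavy_eq_empty_le`, `ε` its conclusion.
  have hδ : 0 < min ε (1 / 4) := lt_min hε (by norm_num)
  filter_upwards [tendsto_log_natCast.eventually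
      (eventually_mul_log_le hk hε hε1 (-Real.log (min ε (1 / 4)))),
    (tendsto_log_natCast.eventually ((tendsto_leadingFun hk).eventually_ge_atTop (1 / (1 - ε)))),
    eventually_ge_atTop 1] with n h1 h2 hn _ τ
  have hn0 : (0 : ℝ) < n := by exact_mod_cast hn
  rw [div_le_iff₀' (by linarith)] at h2
  rw [leadingTerm_eq]
  set a := leadingFun k (Real.log n)
  set m := ⌊(1 - ε) * a⌋₊ with hm
  have hm1 : 1 ≤ m := Nat.le_floor (by simpa using h2)
  have hm1' : (1 : ℝ) ≤ m := by exact_mod_cast hm1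
  have h3 := h1 m hm1 (Nat.floor_le (by linarith))
  set S := ∑ j ∈ Finset.range m, k ^ j
  have h2k : (1 : ℝ) ≤ 2 ^ (k + 3) := one_le_pow₀ (by norm_num)
  set D : ℝ := 2 ^ (k + 3) * m with hD
  have hmD : m ≤ D := by nlinarith
  have hD1 : 1 ≤ D := hm1'.trans hmD
  have h4 : D ^ (S + 1) ≤ min ε (1 / 4) * n := by
    rw [← Real.log_le_log_iff (by positivity) (by positivity), Real.log_pow,
      Real.log_mul hδ.ne' hn0.ne']
    push_cast
    linarith
  have h5 : D ^ (S + 1) ≤ ε * n := h4.trans (by gcongr; exact min_le_left _ _)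
  have h6 : D ^ (S + 1) ≤ 1 / 4 * n := h4.trans (by gcongr; exact min_le_right _ _)
  have h7 : D ^ S ≤ D ^ (S + 1) := pow_le_pow_right₀ hD1 (Nat.le_succ S)
  calc _ ≤ prob (kApproxLine τ) {E | heavy E m = ∅} := by
        refine prob_mono fun E _ hE => ?_
        refine Finset.eq_empty_of_forall_notMem fun u hu => ?_
        have h8 := hE u
        have h9 : (m : ℝ) ≤ inDeg E u := by exact_mod_cast mem_heavy.1 hu
        have h10 := Nat.lt_floor_add_one ((1 - ε) * a)
        rw [← hm] at h10
        linarith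
    _ ≤ m * D ^ S / n := prob_heavy_eq_empty_le hk τ hm1 (by linarith)
    _ ≤ ε := by
        rw [div_le_iff₀ hn0]
        refine le_trans ?_ h5
        rw [pow_succ']
        gcongr

/-- No node has in-degree much larger than the leading term. -/
lemma eventually_prob_exists_le_inDeg_le (hk : 1 ≤ k) {ε : ℝ} (hε : 0 < ε) (hε1 : ε < 1) :
    ∀ᶠ n : ℕ in atTop, ∀ [Nontrivial (Fin n)] (τ : TieRule (Fin n) k),
      prob (kApproxLine τ) {E | ∃ u, (1 + ε) * leadingTerm k n ≤ inDeg E u} ≤ ε := by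
  by_cases hk1 : k = 1
  · subst hk1
    have hc : 0 < ε / 4 := by linarith
    filter_upwards [tendsto_log_natCast.eventually_ge_atTop (4 / ε),
      tendsto_log_natCast.eventually_ge_atTop (4 / ε * -Real.log ε),
      (Real.tendsto_log_atTop.comp tendsto_log_natCast).eventually_ge_atTop
        (max 1 ((1 + ε) * -Real.log (ε / 4) / (ε / 4))),
      eventually_ge_atTop 1] with n h1 h2 h3 hn _ τ
    have hn0 : (0 : ℝ) < n := by exact_mod_cast hn
    rw [leadingTerm_eq, leadingFun, if_pos rfl]
    set y := Real.log n with hy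
    have hy0 : 0 < y := lt_of_lt_of_le (by positivity) h1
    rw [div_le_iff₀ hε] at h1
    have h3a : 1 ≤ Real.log y := (le_max_left _ _).trans h3
    have h3b : (1 + ε) * -Real.log (ε / 4) / (ε / 4) ≤ Real.log y := (le_max_right _ _).trans h3
    rw [div_le_iff₀ hc] at h3b
    -- With `x = ε / 4 * y`, the factor `n * exp (2 * x)` costs `(1 + ε / 2) * y` in the exponent
    -- and `x ^ s` gains at least `(1 + ε - ε / 4) * y`; a decay of `ε / 4 * y` remains.
    have hx : 1 ≤ ε / 4 * y := by linarith
    have h4 := rpow_mul_prob_exists_inDeg_le τ hx ((1 + ε) * (y / Real.log y))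
    have h5 : (n : ℝ) = Real.exp y := (Real.exp_log hn0).symm
    rw [Real.rpow_def_of_pos (by linarith), h5, ← Real.exp_add, ← le_div_iff₀' (Real.exp_pos _),
      ← Real.exp_sub] at h4
    refine h4.trans ?_
    rw [← Real.le_log_iff_exp_le hε, Real.log_mul hc.ne' hy0.ne']
    have hL : 0 < Real.log y := by linarith
    have h6 : (Real.log (ε / 4) + Real.log y) * ((1 + ε) * (y / Real.log y)) =
        (1 + ε) * y - (1 + ε) * -Real.log (ε / 4) * (y / Real.log y) := by
      field_simp
      ring
    have h7 : (1 + ε) * -Real.log (ε / 4) * (y / Real.log y) ≤ ε / 4 * y := by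
      rw [mul_div_assoc', div_le_iff₀ hL]
      nlinarith
    have h8 : -Real.log ε ≤ ε / 4 * y := by
      have := mul_le_mul_of_nonneg_left h2 hc.le
      have h9 : ε / 4 * (4 / ε * -Real.log ε) = -Real.log ε := by field_simp
      linarith
    rw [h6]
    linarith
  · have hk2 : 2 ≤ k := by omega
    have hlk : 0 < Real.log k := Real.log_pos (by exact_mod_cast (by omega : 1 < k))
    set s := ⌈16 * (2 / ε)⌉₊ with hs
    filter_upwards [tendsto_log_natCast.eventually_ge_atTop 1,
      tendsto_log_natCast.eventually ((tendsto_leadingFun hk).eventually_ge_atTop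
        ((s + 1 + Real.log 2 / Real.log k) / ε)), eventually_ge_atTop 1] with n h1 h2 hn _ τ
    have hn0 : (0 : ℝ) < n := by exact_mod_cast hn
    rw [leadingTerm_eq]
    rw [div_le_iff₀' hε] at h2
    set a := leadingFun k (Real.log n) with ha
    have ha' : a = Real.log (Real.log n) / Real.log k := by rw [ha, leadingFun, if_neg hk1]
    -- The factor 2 compensates for `log 2 < 1` in `n ≤ 2 ^ k ^ j`; it costs only a bounded number
    -- of levels.
    set z := Real.log (2 * Real.log n) / Real.log k with hz
    have hza : z = Real.log 2 / Real.log k + a := by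
      rw [hz, ha', Real.log_mul (by norm_num) (by linarith), add_div]
    have hz0 : 0 ≤ z := div_nonneg (Real.log_nonneg (by linarith)) hlk.le
    have hj : n ≤ 2 ^ k ^ ⌈z⌉₊ := by
      have h3 : 2 * Real.log n ≤ (k : ℝ) ^ ⌈z⌉₊ := by
        have h4 : Real.log (2 * Real.log n) ≤ ⌈z⌉₊ * Real.log k := by
          have := Nat.le_ceil z
          rwa [hz, div_le_iff₀ hlk] at this
        rw [← Real.log_pow] at h4
        exact (Real.log_le_log_iff (by linarith) (by positivity)).1 h4
      have h5 : Real.log n ≤ Real.log (2 ^ k ^ ⌈z⌉₊) := by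
        rw [Real.log_pow]
        push_cast
        have := Real.log_two_gt_d9
        nlinarith
      have h6 := (Real.log_le_log_iff hn0 (by positivity)).1 h5
      exact_mod_cast h6
    have hM : 1 ≤ 2 / ε := by
      rw [le_div_iff₀ hε]
      linarith
    calc _ ≤ prob (kApproxLine τ) {E | (heavy E (s + ⌈z⌉₊)).Nonempty} := by
          refine prob_mono fun E _ hE => ?_
          obtain ⟨u, hu⟩ := hE
          refine ⟨u, mem_heavy.2 ?_⟩
          have h7 := Nat.ceil_lt_add_one hz0
          have h8 : ((s + ⌈z⌉₊ : ℕ) : ℝ) ≤ inDeg E u := by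
            push_cast
            linarith
          exact_mod_cast h8
      _ ≤ 2 / (2 / ε) := prob_heavy_nonempty_le hk2 τ hM (Nat.le_ceil _) hj
      _ = ε := by field_simp

/-- The largest degree divided by the leading term tends to one in probability, uniformly in the
tie-breaking rule. -/
lemma eventually_le_prob_abs_maxDeg_sub_le (hk : 1 ≤ k) {ε : ℝ} (hε : 0 < ε) (hε1 : ε ≤ 1) :
    ∀ᶠ n : ℕ in atTop, 0 < leadingTerm k n ∧
      ∀ [Nontrivial (Fin n)] (τ : TieRule (Fin n) k), 1 - ε ≤ prob (kApproxLine τ)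
        {E | |(maxDeg E : ℝ) - 1 - leadingTerm k n| ≤ ε * leadingTerm k n} := by
  filter_upwards [eventually_prob_forall_inDeg_lt_le hk (half_pos hε) (by linarith),
    eventually_prob_exists_le_inDeg_le hk (half_pos hε) (by linarith),
    tendsto_log_natCast.eventually ((tendsto_leadingFun hk).eventually_ge_atTop (4 / ε))]
    with n h1 h2 h3
  rw [← leadingTerm_eq] at h3
  have ha : 0 < leadingTerm k n := lt_of_lt_of_le (by positivity) h3
  refine ⟨ha, fun {_} τ => ?_⟩
  specialize h1 τ
  specialize h2 τ
  rw [div_le_iff₀' hε] at h3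
  set a := leadingTerm k n
  set p := kApproxLine τ with hp
  have key : prob p {E | |(maxDeg E : ℝ) - 1 - a| ≤ ε * a}ᶜ ≤
      prob p ({E | ∀ u, (inDeg E u : ℝ) < (1 - ε / 2) * a - 1} ∪
        {E | ∃ u, (1 + ε / 2) * a ≤ inDeg E u}) := by
    refine prob_mono fun E hE hbad => ?_
    by_contra hgood
    simp only [Set.mem_union, Set.mem_ofPred_eq, not_or, not_forall, not_exists, not_lt,
      not_le] at hgood
    obtain ⟨⟨u, hu⟩, hall⟩ := hgood
    refine hbad (show |(maxDeg E : ℝ) - 1 - a| ≤ ε * a from abs_le.2 ⟨?_, ?_⟩)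
    · have h4 : inDeg E u ≤ maxDeg E :=
        (Nat.le_add_left _ _).trans (Finset.le_sup (f := deg E) (Finset.mem_univ u))
      have h5 : (inDeg E u : ℝ) ≤ maxDeg E := by exact_mod_cast h4
      linarith
    · obtain ⟨w, -, hw⟩ := Finset.exists_mem_eq_sup Finset.univ ⟨u, Finset.mem_univ u⟩ (deg E)
      rw [hp, kApproxLine_eq_run] at hE
      have h6 := outDeg_le_one_of_mem_support_run (List.nodup_finRange n) hE w
      have h7 : maxDeg E ≤ 1 + inDeg E w := by
        rw [maxDeg, hw, deg]
        omega
      have h8 : (maxDeg E : ℝ) ≤ 1 + inDeg E w := by exact_mod_cast h7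
      have := hall w
      nlinarith
  rw [prob_compl] at key
  have := prob_union_le p {E | ∀ u, (inDeg E u : ℝ) < (1 - ε / 2) * a - 1}
    {E | ∃ u, (1 + ε / 2) * a ≤ inDeg E u}
  linarith

/-- A property that holds eventually for each tolerance holds eventually for tolerances that tend
to zero. -/
lemma exists_seq_tendsto_zero_of_eventually {Q : ℕ → ℝ → Prop}
    (h : ∀ ε, 0 < ε → ε ≤ 1 → ∀ᶠ n in atTop, Q n ε) :
    ∃ ε : ℕ → ℝ, Tendsto ε atTop (𝓝 0) ∧ ∀ᶠ n in atTop, Q n (ε n) := by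
  classical
  have h' : ∀ j : ℕ, ∀ᶠ n in atTop, Q n (1 / ((j : ℝ) + 1)) := fun j =>
    h _ (by positivity) ((div_le_one (by positivity)).2 (by linarith [j.cast_nonneg (α := ℝ)]))
  -- Diagonal choice of the smallest tolerance available at `n`. The default value 0 of
  -- `Nat.findGreatest` is harmless, since tolerance 1 eventually works.
  set J : ℕ → ℕ := fun n => Nat.findGreatest (fun j => Q n (1 / ((j : ℝ) + 1))) n with hJ
  refine ⟨fun n => 1 / ((J n : ℝ) + 1), ?_, ?_⟩
  · refine tendsto_one_div_add_atTop_nhds_zero_nat.comp (tendsto_atTop.2 fun j => ?_)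
    filter_upwards [h' j, eventually_ge_atTop j] with n hn hjn
    exact Nat.le_findGreatest hjn hn
  · filter_upwards [h' 0] with n hn
    exact Nat.findGreatest_spec (P := fun j : ℕ => Q n (1 / ((j : ℝ) + 1))) (Nat.zero_le n) hn

end Asymptotics

end ApproxLine

theorem mainTheorem12 (k : ℕ) (hk : 1 ≤ k) :
    ∃ (ε η : ℕ → ℝ) (c C : ℝ),
      Tendsto ε atTop (𝓝 0) ∧ Tendsto η atTop (𝓝 0) ∧ 0 < c ∧ c ≤ C ∧
      ∀ (n : ℕ) [Nontrivial (Fin n)] (τ : ApproxLine.TieRule (Fin n) k),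
        1 - η n ≤ ApproxLine.prob (ApproxLine.kApproxLine τ)
          {E | ∃ δ θ : ℝ, |δ| ≤ ε n ∧ c ≤ θ ∧ θ ≤ C ∧
            (ApproxLine.maxDeg E : ℝ) = ApproxLine.leadingTerm k n * (1 + δ) + θ} := by
  obtain ⟨ε, hε, hev⟩ := ApproxLine.exists_seq_tendsto_zero_of_eventually fun ε h0 h1 =>
    ApproxLine.eventually_le_prob_abs_maxDeg_sub_le hk (ε := ε) h0 h1
  obtain ⟨N, hN⟩ := eventually_atTop.1 hev
  -- The bounded term can be exactly 1, with all fluctuation put into `δ`; below `N` the value 1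
  -- makes the probability bound trivial.
  refine ⟨ε, fun n => if N ≤ n then ε n else 1, 1, 1, hε, ?_, one_pos, le_rfl, fun n _ τ => ?_⟩
  · refine hε.congr' ?_
    filter_upwards [eventually_ge_atTop N] with n hn
    rw [if_pos hn]
  · dsimp only
    split_ifs with hn
    · obtain ⟨ha, h⟩ := hN n hn
      refine (h τ).trans (ApproxLine.prob_mono fun E _ hE => ?_)
      refine ⟨((ApproxLine.maxDeg E : ℝ) - 1 - ApproxLine.leadingTerm k n) /
        ApproxLine.leadingTerm k n, 1, ?_, le_rfl, le_rfl, ?_⟩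
      · rw [abs_div, abs_of_pos ha, div_le_iff₀ ha]
        exact hE
      · field_simp
        ring
    · rw [sub_self]
      exact ApproxLine.prob_nonneg _ _
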